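/- Let $M$ and $N$ be compact connected Riemann surfaces, let $p\in M$, let $U\subset N$ be an open subset, and let $\varphi\colon U\to M\setminus\{p\}$ be a biholomorphism (where $U$ and $M\setminus\{p\}$ carry the complex structures induced from $N$ and $M$). Then $\varphi$ extends to a biholomorphism of $N$ onto $M$: there is a biholomorphism $\Phi\colon N\to M$ with $\Phi(x)=\varphi(x)$ for all $x\in U$. -/

import Mathlib

open scoped Manifold ContDiff

/-- The complement `M ∖ {p}` of a point, as an open subset of `M`. It carries the complex structure
that it inherits from `M` as an open subset. -/
def puncture {M : Type*} [TopologicalSpace M] [T1Space M] (p : M) : TopologicalSpace.Opens M :=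
  ⟨{p}ᶜ, isOpen_compl_singleton⟩

/-- A biholomorphism between complex manifolds of dimension one: a bijection that is complex
analytic in both directions. -/
abbrev Biholomorphism (X Y : Type*) [TopologicalSpace X] [ChartedSpace ℂ X]
    [TopologicalSpace Y] [ChartedSpace ℂ Y] :=
  Diffeomorph 𝓘(ℂ) 𝓘(ℂ) X Y ω

/-! Send `N ∖ U` to `p`. Compactness of `M` makes this extension `f` of `φ` continuous, and it is
holomorphic off the fibre over `p`. Nothing is known about the size of that fibre, so Radó's theorem
is needed: a continuous function holomorphic off its zero set is holomorphic.

The engine is a maximum principle that ignores zeros of `f`. It shows that the interior of the fibre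
is closed, hence empty since `N` is connected, and it bounds Taylor remainders uniformly, which
yields derivatives at zeros. The open mapping theorem then forces the fibre to be one point (two
would give `f` repeated values on `U`), and the inverse has a removable singularity at `p`. -/

open Filter Topology Metric

/-! ### Radó's theorem in a disc -/

/-- The maximum modulus principle on the complement of the zero set of a function `f`: zeros of `f`
do not count as boundary points. -/
theorem norm_le_of_sphere_bound_off_zeros {f g : ℂ → ℂ} {c : ℂ} {R M : ℝ}
    (hf : ContinuousOn f (closedBall c R))
    (hfd : ∀ z ∈ ball c R, f z ≠ 0 → DifferentiableAt ℂ f z)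
    (hg : ContinuousOn g (closure (ball c R ∩ {z | f z ≠ 0})))
    (hgd : ∀ z ∈ ball c R, f z ≠ 0 → DifferentiableAt ℂ g z)
    (hM0 : 0 ≤ M) (hM : ∀ z ∈ sphere c R, ‖g z‖ ≤ M)
    {z : ℂ} (hz : z ∈ ball c R) (hfz : f z ≠ 0) : ‖g z‖ ≤ M := by
  set Ω := ball c R ∩ {z | f z ≠ 0} with hΩ
  have hΩsub : closure Ω ⊆ closedBall c R :=
    (closure_mono Set.inter_subset_left).trans closure_ball_subset_closedBall
  have hΩo : IsOpen Ω :=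
    (hf.mono ball_subset_closedBall).isOpen_inter_preimage isOpen_ball isOpen_compl_singleton
  obtain ⟨A, hA⟩ := (isCompact_closedBall c R).exists_bound_of_continuousOn hf
  have hA0 : 0 ≤ A := (norm_nonneg _).trans (hA z (ball_subset_closedBall hz))
  refine le_of_forall_gt_imp_ge_of_dense fun m hMm => ?_
  by_contra! hlt
  have hm0 : 0 < m := hM0.trans_lt hMm
  -- `f * g ^ n` vanishes at the zeros of `f`, so only the sphere contributes to the bound; letting
  -- `n` grow removes the factor `f`.
  have key (n : ℕ) : ‖f z‖ * ‖g z‖ ^ n ≤ A * m ^ n := by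
    have hd : DiffContOnCl ℂ (fun z => f z * g z ^ n) Ω :=
      ⟨fun w hw => ((hfd w hw.1 hw.2).mul ((hgd w hw.1 hw.2).pow n)).differentiableWithinAt,
        (hf.mono hΩsub).mul (hg.pow n)⟩
    have := Complex.norm_le_of_forall_mem_frontier_norm_le (U := Ω)
      (isBounded_ball.subset Set.inter_subset_left) hd (C := A * m ^ n) ?_
      (subset_closure ⟨hz, hfz⟩)
    · simpa using this
    · intro w hw
      have hwc : w ∈ closure Ω := hw.1
      have hwn : w ∉ Ω := by simpa [hΩo.interior_eq] using hw.2
      rw [norm_mul, norm_pow]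
      by_cases hfw : f w = 0
      · rw [hfw, norm_zero, zero_mul]; positivity
      · have hws : w ∈ sphere c R := by
          have h1 := mem_closedBall.1 (hΩsub hwc)
          have h2 : ¬ dist w c < R := fun h => hwn ⟨h, hfw⟩
          exact mem_sphere.2 (le_antisymm h1 (not_lt.1 h2))
        exact mul_le_mul (hA w (hΩsub hwc))
          (pow_le_pow_left₀ (norm_nonneg _) ((hM w hws).trans hMm.le) n) (by positivity) hA0
  have hfz' : 0 < ‖f z‖ := norm_pos_iff.2 hfz
  have hr : 1 < ‖g z‖ / m := by rwa [one_lt_div hm0]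
  obtain ⟨n, hn⟩ := pow_unbounded_of_one_lt (A / ‖f z‖) hr
  have := key n
  rw [div_pow, div_lt_div_iff₀ hfz' (by positivity)] at hn
  linarith

/-- A zero of `f` that is a limit of points where `f` does not vanish is not a limit of interior
points of the zero set. -/
theorem notMem_closure_interior_zeros {f : ℂ → ℂ} {c : ℂ} {R : ℝ} (hR : 0 < R)
    (hf : ContinuousOn f (closedBall c R))
    (hfd : ∀ z ∈ ball c R, f z ≠ 0 → DifferentiableAt ℂ f z)
    (hc : c ∈ closure {z | f z ≠ 0}) : c ∉ closure (interior {z | f z = 0}) := by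
  intro hi
  obtain ⟨a, ha, hac⟩ := Metric.mem_closure_iff.1 hi (R / 4) (by linarith)
  obtain ⟨α, hα, hαc⟩ := Metric.mem_closure_iff.1 hc (R / 4) (by linarith)
  have hne : ∀ z ∈ closure (ball c R ∩ {z | f z ≠ 0}), z - a ≠ 0 := by
    intro z hz hza
    rw [sub_eq_zero.1 hza] at hz
    obtain ⟨w, hw, hw'⟩ := mem_closure_iff.1 hz _ isOpen_interior ha
    have h0 : w ∈ {z | f z = 0} := interior_subset hw
    exact hw'.2 h0
  have hαb : α ∈ ball c R := by rw [mem_ball, dist_comm]; linarith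
  -- The pole `a` is at least `3R/4` from the sphere, yet `α` is within `R/2` of `a`, so `1/(z - a)`
  -- is larger at `α` than its bound on the sphere.
  have h := norm_le_of_sphere_bound_off_zeros (g := fun z => (z - a)⁻¹) (M := (R * (3 / 4))⁻¹)
    hf hfd ((continuousOn_id.sub continuousOn_const).inv₀ hne)
    (fun z hz hfz => (differentiableAt_id.sub_const a).inv (hne z (subset_closure ⟨hz, hfz⟩)))
    (by positivity) ?_ hαb hα
  · have hpos : 0 < ‖α - a‖ := norm_pos_iff.2 (hne α (subset_closure ⟨hαb, hα⟩))
    rw [norm_inv, inv_le_inv₀ hpos (by positivity), ← dist_eq_norm] at h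
    have := dist_triangle_left α a c
    linarith
  · intro z hz
    rw [norm_inv, ← dist_eq_norm]
    refine inv_anti₀ (by positivity) ?_
    have := dist_triangle_right z c a
    rw [mem_sphere] at hz
    linarith

/-- The numerator is at most `2A` and the denominator at least `R/2`. The maximum principle carries
such bounds inside the disc. -/
theorem norm_dslope_le_on_sphere {g : ℂ → ℂ} {c α : ℂ} {R A : ℝ} (hR : 0 < R)
    (hα : dist α c ≤ R / 2) (hA : ∀ z ∈ sphere c R, ‖g z‖ ≤ A) (hAα : ‖g α‖ ≤ A) :
    ∀ z ∈ sphere c R, ‖dslope g α z‖ ≤ 4 * A / R := by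
  intro z hz
  have hd : R / 2 ≤ ‖z - α‖ := by
    rw [← dist_eq_norm]
    have := dist_triangle z α c
    rw [mem_sphere] at hz
    linarith
  have hne : z ≠ α := by
    rintro rfl
    rw [sub_self, norm_zero] at hd
    linarith
  rw [dslope_of_ne _ hne, slope_def_field, norm_div]
  have h2 : ‖g z - g α‖ ≤ 2 * A := by
    have := norm_sub_le (g z) (g α)
    have := hA z hz
    linarith
  calc ‖g z - g α‖ / ‖z - α‖ ≤ 2 * A / (R / 2) :=
        div_le_div₀ ((norm_nonneg _).trans h2) h2 (by positivity) hd
    _ = 4 * A / R := by field_simp; ring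

/-- A first-order Taylor bound off the zero set, uniform in the base point. -/
theorem exists_taylor_bound_off_zeros {f : ℂ → ℂ} {c : ℂ} {R : ℝ} (hR : 0 < R)
    (hf : ContinuousOn f (closedBall c R))
    (hfd : ∀ z ∈ ball c R, f z ≠ 0 → DifferentiableAt ℂ f z) :
    ∃ A B : ℝ, ∀ α ∈ closedBall c (R / 2), f α ≠ 0 → ‖deriv f α‖ ≤ A ∧
      ∀ z ∈ ball c R, f z ≠ 0 → ‖f z - f α - (z - α) * deriv f α‖ ≤ B * ‖z - α‖ ^ 2 := by
  obtain ⟨A, hA⟩ := (isCompact_closedBall c R).exists_bound_of_continuousOn hf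
  have hA0 : 0 ≤ A := (norm_nonneg _).trans (hA c (mem_closedBall_self hR.le))
  have hsub : closure (ball c R ∩ {z | f z ≠ 0}) ⊆ closedBall c R :=
    (closure_mono Set.inter_subset_left).trans closure_ball_subset_closedBall
  have hΩo : IsOpen (ball c R ∩ {z | f z ≠ 0}) :=
    (hf.mono ball_subset_closedBall).isOpen_inter_preimage isOpen_ball isOpen_compl_singleton
  refine ⟨4 * A / R, 4 * (4 * A / R) / R, fun α hα hfα => ?_⟩
  have hαc : dist α c ≤ R / 2 := hα
  have hαb : α ∈ ball c R := by rw [mem_ball]; linarith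
  have hnhds : closedBall c R ∈ 𝓝 α := mem_of_superset (isOpen_ball.mem_nhds hαb)
    ball_subset_closedBall
  have step (g : ℂ → ℂ) (hg : ContinuousOn g (closedBall c R))
      (hgd : ∀ z ∈ ball c R, f z ≠ 0 → DifferentiableAt ℂ g z) :
      ContinuousOn (dslope g α) (closedBall c R) ∧
      ∀ z ∈ ball c R, f z ≠ 0 → DifferentiableAt ℂ (dslope g α) z := by
    refine ⟨(continuousOn_dslope hnhds).2 ⟨hg, hgd α hαb hfα⟩, fun z hz hfz => ?_⟩
    have hd : DifferentiableOn ℂ (dslope g α) (ball c R ∩ {z | f z ≠ 0}) :=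
      (Complex.differentiableOn_dslope (hΩo.mem_nhds ⟨hαb, hfα⟩)).2 fun w hw =>
        (hgd w hw.1 hw.2).differentiableWithinAt
    exact hd.differentiableAt (hΩo.mem_nhds ⟨hz, hfz⟩)
  -- The second difference quotient is the Taylor remainder over `(z - α) ^ 2`; bounding it needs
  -- the first one bounded at `α` too, where it is the derivative.
  obtain ⟨c1, d1⟩ := step f hf hfd
  obtain ⟨c2, d2⟩ := step _ c1 d1
  have hs1 := norm_dslope_le_on_sphere hR hαc (fun z hz => hA z (sphere_subset_closedBall hz))
    (hA α (ball_subset_closedBall hαb))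
  have b1 := norm_le_of_sphere_bound_off_zeros hf hfd (c1.mono hsub) d1 (by positivity) hs1 hαb hfα
  have hs2 := norm_dslope_le_on_sphere hR hαc hs1 b1
  refine ⟨by rwa [dslope_same] at b1, fun z hz hfz => ?_⟩
  have b2 := norm_le_of_sphere_bound_off_zeros hf hfd (c2.mono hsub) d2 (by positivity) hs2 hz hfz
  have e : f z - f α - (z - α) * deriv f α
      = (z - α) ^ 2 * dslope (dslope f α) α z := by
    have e1 := sub_smul_dslope f α z
    have e2 := sub_smul_dslope (dslope f α) α z
    rw [dslope_same] at e2
    simp only [smul_eq_mul] at e1 e2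
    linear_combination -e1 - (z - α) * e2
  rw [e, norm_mul, norm_pow, mul_comm]
  gcongr

/-- **Radó's theorem**, under the assumption that the zero set has no interior. -/
theorem differentiableAt_of_differentiableAt_off_zeros {f : ℂ → ℂ} {c : ℂ} {R : ℝ} (hR : 0 < R)
    (hf : ContinuousOn f (closedBall c R))
    (hfd : ∀ z ∈ ball c R, f z ≠ 0 → DifferentiableAt ℂ f z)
    (hdense : ball c R ⊆ closure {z | f z ≠ 0}) : DifferentiableAt ℂ f c := by
  obtain ⟨A, B, hAB⟩ := exists_taylor_bound_off_zeros hR hf hfd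
  have hcont (z : ℂ) (hz : z ∈ ball c R) : ContinuousAt f z :=
    hf.continuousAt (mem_of_superset (isOpen_ball.mem_nhds hz) ball_subset_closedBall)
  have hcb : c ∈ ball c R := mem_ball_self hR
  obtain ⟨u, hu, huc⟩ := mem_closure_iff_seq_limit.1 (hdense hcb)
  have hev : ∀ᶠ n in atTop, u n ∈ closedBall c (R / 2) :=
    huc.eventually_mem (closedBall_mem_nhds c (by linarith))
  -- A limit of the bounded derivatives at nearby nonzeros is the candidate derivative at `c`.
  obtain ⟨d, -, s, hs, hd⟩ := tendsto_subseq_of_frequently_bounded (isBounded_closedBall (x := 0)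
    (r := A)) (x := fun n => deriv f (u n))
    (hev.mono fun n hn => by simpa using (hAB (u n) hn (hu n)).1).frequently
  have hus := huc.comp hs.tendsto_atTop
  have h1 (z : ℂ) (hz : z ∈ ball c R) (hfz : f z ≠ 0) :
      ‖f z - f c - (z - c) * d‖ ≤ B * ‖z - c‖ ^ 2 := by
    refine le_of_tendsto_of_tendsto
      (((tendsto_const_nhds.sub ((hcont c hcb).tendsto.comp hus)).sub
        ((tendsto_const_nhds.sub hus).mul hd)).norm)
      (((tendsto_const_nhds.sub hus).norm.pow 2).const_mul B) ?_
    filter_upwards [hs.tendsto_atTop.eventually hev] with n hn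
    exact (hAB _ hn (hu _)).2 z hz hfz
  have h2 (z : ℂ) (hz : z ∈ ball c R) : ‖f z - f c - (z - c) * d‖ ≤ B * ‖z - c‖ ^ 2 := by
    obtain ⟨v, hv, hvz⟩ := mem_closure_iff_seq_limit.1 (hdense hz)
    refine le_of_tendsto_of_tendsto
      ((((hcont z hz).tendsto.comp hvz).sub tendsto_const_nhds).sub
        ((hvz.sub tendsto_const_nhds).mul tendsto_const_nhds)).norm
      (((hvz.sub tendsto_const_nhds).norm.pow 2).const_mul B) ?_
    filter_upwards [hvz.eventually_mem (isOpen_ball.mem_nhds hz)] with n hn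
    exact h1 _ hn (hv n)
  have hda : HasDerivAt f d c := by
    rw [hasDerivAt_iff_isLittleO]
    have hO : (fun z => f z - f c - (z - c) • d) =O[𝓝 c] fun z => (z - c) ^ 2 :=
      Asymptotics.IsBigO.of_bound B <| by
        filter_upwards [isOpen_ball.mem_nhds hcb] with z hz
        simpa using h2 z hz
    refine hO.trans_isLittleO ?_
    have := (Asymptotics.isLittleO_pow_id (𝕜 := ℂ) one_lt_two).comp_tendsto
      (tendsto_sub_nhds_zero_iff.2 (tendsto_id (α := ℂ) (x := 𝓝 c)))
    exact this
  exact hda.differentiableAt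

/-- **Radó's theorem** near a point, under the assumption that the zero set has no interior. -/
theorem analyticAt_of_differentiableAt_off_zeros {f : ℂ → ℂ} {c : ℂ} {R : ℝ} (hR : 0 < R)
    (hf : ContinuousOn f (closedBall c R))
    (hfd : ∀ z ∈ ball c R, f z ≠ 0 → DifferentiableAt ℂ f z)
    (hdense : ball c R ⊆ closure {z | f z ≠ 0}) : AnalyticAt ℂ f c := by
  refine DifferentiableOn.analyticAt (s := ball c R) (fun z hz => ?_) (ball_mem_nhds c hR)
  obtain ⟨r, hr, hrs⟩ := Metric.nhds_basis_closedBall.mem_iff.1 (isOpen_ball.mem_nhds hz)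
  have hrs' := ball_subset_closedBall.trans hrs
  exact (differentiableAt_of_differentiableAt_off_zeros hr
    (hf.mono (hrs.trans ball_subset_closedBall)) (fun w hw => hfd w (hrs' hw))
    (hrs'.trans hdense)).differentiableWithinAt

/-! ### Transfer to Riemann surfaces -/

section Charts

variable {X Y : Type*} [TopologicalSpace X] [ChartedSpace ℂ X] [IsManifold 𝓘(ℂ) ω X]
  [TopologicalSpace Y] [ChartedSpace ℂ Y] [IsManifold 𝓘(ℂ) ω Y]

theorem contMDiffAt_iff_analyticAt_charts {f : X → Y} {x z : X} {y : Y}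
    (hz : z ∈ (chartAt ℂ x).source) (hfz : f z ∈ (chartAt ℂ y).source) (hf : ContinuousAt f z) :
    ContMDiffAt 𝓘(ℂ) 𝓘(ℂ) ω f z ↔
      AnalyticAt ℂ (chartAt ℂ y ∘ f ∘ (chartAt ℂ x).symm) (chartAt ℂ x z) := by
  rw [contMDiffAt_iff_of_mem_source hz hfz]
  simp only [hf, true_and, mfld_simps]
  rw [contDiffWithinAt_omega_iff_analyticWithinAt, analyticWithinAt_univ]

/-- A continuous map between complex curves that is holomorphic on a punctured neighbourhood of a
point is holomorphic at that point. -/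
theorem contMDiffAt_of_punctured_nhds {f : X → Y} {x : X} (hf : ContinuousAt f x)
    (h : ∀ᶠ z in 𝓝[≠] x, ContMDiffAt 𝓘(ℂ) 𝓘(ℂ) ω f z) : ContMDiffAt 𝓘(ℂ) 𝓘(ℂ) ω f x := by
  set e := chartAt ℂ x
  set e' := chartAt ℂ (f x)
  have hx : x ∈ e.source := mem_chart_source ℂ x
  have hfx : f x ∈ e'.source := mem_chart_source ℂ (f x)
  rw [contMDiffAt_iff_analyticAt_charts hx hfx hf]
  have hsymm : Tendsto e.symm (𝓝 (e x)) (𝓝 x) := e.tendsto_symm hx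
  refine Complex.analyticAt_of_differentiable_on_punctured_nhds_of_continuousAt ?_ ?_
  · have h1 : ∀ᶠ z in 𝓝 x, z ≠ x → ContMDiffAt 𝓘(ℂ) 𝓘(ℂ) ω f z := eventually_nhdsWithin_iff.1 h
    have h2 : ∀ᶠ z in 𝓝 x, f z ∈ e'.source := hf.eventually (e'.open_source.mem_nhds hfx)
    rw [eventually_nhdsWithin_iff]
    filter_upwards [hsymm.eventually h1, hsymm.eventually h2,
      e.open_target.mem_nhds (e.map_source hx)] with w hw1 hw2 hw3 hwx
    have hne : e.symm w ≠ x := by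
      intro h0
      exact hwx (by rw [Set.mem_singleton_iff, ← e.right_inv hw3, h0])
    have := (contMDiffAt_iff_analyticAt_charts (e.map_target hw3) hw2
      (hw1 hne).continuousAt).1 (hw1 hne)
    rw [e.right_inv hw3] at this
    exact this.differentiableAt
  · have hl : e.symm (e x) = x := e.left_inv hx
    refine ContinuousAt.comp (g := e') ?_ (ContinuousAt.comp (g := f) ?_ ?_)
    · simpa [hl] using e'.continuousAt hfx
    · rwa [hl]
    · exact e.continuousAt_symm (e.map_source hx)

/-- The coordinate expression of a continuous map `f` at `x`, normalised to vanish at `x`. -/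
noncomputable def centeredChartExpr (f : X → Y) (x : X) (z : ℂ) : ℂ :=
  chartAt ℂ (f x) (f ((chartAt ℂ x).symm z)) - chartAt ℂ (f x) (f x)

theorem exists_ball_centeredChartExpr {f : X → Y} (hf : Continuous f) (x : X)
    (h : ∀ z, f z ≠ f x → ContMDiffAt 𝓘(ℂ) 𝓘(ℂ) ω f z) :
    ∃ R > 0, closedBall (chartAt ℂ x x) R ⊆ (chartAt ℂ x).target ∧
      ContinuousOn (centeredChartExpr f x) (closedBall (chartAt ℂ x x) R) ∧
      (∀ z ∈ closedBall (chartAt ℂ x x) R,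
        f ((chartAt ℂ x).symm z) ∈ (chartAt ℂ (f x)).source ∧
        (centeredChartExpr f x z = 0 ↔ f ((chartAt ℂ x).symm z) = f x)) ∧
      ∀ z ∈ ball (chartAt ℂ x x) R, centeredChartExpr f x z ≠ 0 →
        DifferentiableAt ℂ (centeredChartExpr f x) z := by
  set e := chartAt ℂ x with he
  set e' := chartAt ℂ (f x) with he'
  have hx : x ∈ e.source := mem_chart_source ℂ x
  have hfx : f x ∈ e'.source := mem_chart_source ℂ (f x)
  have hsymm : Tendsto e.symm (𝓝 (e x)) (𝓝 x) := e.tendsto_symm hx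
  have hev : ∀ᶠ w in 𝓝 (e x), w ∈ e.target ∧ f (e.symm w) ∈ e'.source :=
    (e.open_target.eventually_mem (e.map_source hx)).and
      (hsymm.eventually (hf.continuousAt.eventually (e'.open_source.mem_nhds hfx)))
  obtain ⟨R, hR, hRs⟩ := Metric.nhds_basis_closedBall.mem_iff.1 hev
  have hzero : ∀ z ∈ closedBall (e x) R, (centeredChartExpr f x z = 0 ↔ f (e.symm z) = f x) := by
    intro z hz
    rw [centeredChartExpr, sub_eq_zero]
    exact e'.injOn.eq_iff (hRs hz).2 hfx
  refine ⟨R, hR, fun z hz => (hRs hz).1, ?_, fun z hz => ⟨(hRs hz).2, hzero z hz⟩, ?_⟩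
  · refine ContinuousOn.sub (e'.continuousOn.comp (hf.comp_continuousOn
      (e.continuousOn_symm.mono fun z hz => (hRs hz).1)) fun z hz => (hRs hz).2) continuousOn_const
  · intro z hz hne
    have hz' := ball_subset_closedBall hz
    have hcm := h (e.symm z) fun h0 => hne ((hzero z hz').2 h0)
    have := (contMDiffAt_iff_analyticAt_charts (e.map_target (hRs hz').1) (hRs hz').2
      hf.continuousAt).1 hcm
    rw [e.right_inv (hRs hz').1] at this
    exact this.differentiableAt.sub_const _

/-- Closure points of a set pull back along a chart inverse to closure points of its preimage. -/
theorem target_subset_closure_preimage_symm {E H : Type*} [TopologicalSpace E] [TopologicalSpace H]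
    (e : OpenPartialHomeomorph E H) {S : Set E} {z : H} (hz : z ∈ e.target)
    (hS : e.symm z ∈ closure S) : z ∈ closure (e.target ∩ e.symm ⁻¹' S) := by
  rw [_root_.mem_closure_iff] at hS ⊢
  intro o ho hzo
  obtain ⟨w, ⟨hw1, hw2⟩, hwS⟩ := hS _ (e.isOpen_inter_preimage ho)
    ⟨e.map_target hz, by rwa [Set.mem_preimage, e.right_inv hz]⟩
  exact ⟨e w, hw2, e.map_source hw1, by rwa [Set.mem_preimage, e.left_inv hw1]⟩

/-- The interior of a fibre off which a continuous map is holomorphic is closed. -/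
theorem isClosed_interior_fiber [T1Space Y] {f : X → Y} (hf : Continuous f) (y : Y)
    (h : ∀ z, f z ≠ y → ContMDiffAt 𝓘(ℂ) 𝓘(ℂ) ω f z) : IsClosed (interior (f ⁻¹' {y})) := by
  refine isClosed_of_closure_subset fun x hx => ?_
  have hfx : f x = y :=
    closure_minimal interior_subset (isClosed_singleton.preimage hf) hx
  subst hfx
  by_contra hxi
  obtain ⟨R, hR, htar, hcont, hzero, hdiff⟩ := exists_ball_centeredChartExpr hf x h
  set e := chartAt ℂ x with he
  have hxs : x ∈ e.source := mem_chart_source ℂ x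
  have hxt : e x ∈ e.target := e.map_source hxs
  have hb : ball (e x) R ∈ 𝓝 (e x) := ball_mem_nhds _ hR
  -- Otherwise `x` would be a limit both of nonzeros and of interior zeros.
  refine notMem_closure_interior_zeros hR hcont hdiff ?_ ?_
  · have h1 : x ∈ closure (f ⁻¹' {f x})ᶜ := by rwa [closure_compl]
    have h2 := target_subset_closure_preimage_symm e hxt (by rwa [e.left_inv hxs])
    rw [mem_closure_iff_nhds] at h2 ⊢
    intro t ht
    obtain ⟨w, ⟨hwt, hwb⟩, -, hw⟩ := h2 _ (inter_mem ht hb)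
    exact ⟨w, hwt, fun h0 => hw (((hzero w (ball_subset_closedBall hwb)).2).1 h0)⟩
  · have h2 := target_subset_closure_preimage_symm e hxt (by rwa [e.left_inv hxs])
    rw [mem_closure_iff_nhds] at h2 ⊢
    intro t ht
    obtain ⟨w, ⟨hwt, hwb⟩, hw⟩ := h2 _ (inter_mem ht hb)
    refine ⟨w, hwt, ?_⟩
    have ho := (e.isOpen_inter_preimage_symm isOpen_interior (s := interior (f ⁻¹' {f x}))).inter
      (isOpen_ball (x := e x) (ε := R))
    refine mem_interior.2 ⟨_, fun v hv => ?_, ho, hw, hwb⟩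
    have hv' : e.symm v ∈ f ⁻¹' {f x} := interior_subset hv.1.2
    exact ((hzero v (ball_subset_closedBall hv.2)).2).2 hv'

/-- With empty fibre interior the nonzeros are dense, so Radó's theorem applies; the analytic
coordinate expression is then not locally constant, hence open at the point. -/
theorem contMDiffAt_and_nhds_le_map [T1Space Y] {f : X → Y} (hf : Continuous f) (x : X)
    (h : ∀ z, f z ≠ f x → ContMDiffAt 𝓘(ℂ) 𝓘(ℂ) ω f z) (hi : interior (f ⁻¹' {f x}) = ∅) :
    ContMDiffAt 𝓘(ℂ) 𝓘(ℂ) ω f x ∧ 𝓝 (f x) ≤ map f (𝓝 x) := by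
  obtain ⟨R, hR, htar, hcont, hzero, hdiff⟩ := exists_ball_centeredChartExpr hf x h
  set e := chartAt ℂ x with he
  set e' := chartAt ℂ (f x) with he'
  have hxs : x ∈ e.source := mem_chart_source ℂ x
  have hfx : f x ∈ e'.source := mem_chart_source ℂ (f x)
  have hxt : e x ∈ e.target := e.map_source hxs
  have hb : ball (e x) R ∈ 𝓝 (e x) := ball_mem_nhds _ hR
  have hdense : ball (e x) R ⊆ closure {z | centeredChartExpr f x z ≠ 0} := by
    intro z hz
    have h1 : e.symm z ∈ closure (f ⁻¹' {f x})ᶜ := by rw [closure_compl, hi]; simp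
    have h2 := target_subset_closure_preimage_symm e (htar (ball_subset_closedBall hz)) h1
    rw [mem_closure_iff_nhds] at h2 ⊢
    intro t ht
    obtain ⟨w, ⟨hwt, hwb⟩, -, hw⟩ := h2 _ (inter_mem ht (isOpen_ball.mem_nhds hz))
    exact ⟨w, hwt, fun h0 => hw (((hzero w (ball_subset_closedBall hwb)).2).1 h0)⟩
  have han := analyticAt_of_differentiableAt_off_zeros hR hcont hdiff hdense
  have hG : (e' ∘ f ∘ e.symm) = fun z => centeredChartExpr f x z + e' (f x) := by
    ext z; simp [centeredChartExpr, he, he']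
  have hGan : AnalyticAt ℂ (e' ∘ f ∘ e.symm) (e x) := hG ▸ han.add analyticAt_const
  refine ⟨(contMDiffAt_iff_analyticAt_charts hxs hfx hf.continuousAt).2 hGan, ?_⟩
  have hval : (e' ∘ f ∘ e.symm) (e x) = e' (f x) := by simp [e.left_inv hxs]
  rcases hGan.eventually_constant_or_nhds_le_map_nhds with hc | hle
  · exfalso
    obtain ⟨t, ht, hto, hxt'⟩ := _root_.mem_nhds_iff.1 (inter_mem hc hb)
    obtain ⟨w, hwt, hw⟩ := _root_.mem_closure_iff.1 (hdense (mem_ball_self hR)) t hto hxt'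
    refine hw ?_
    have := (ht hwt).1
    change (e' ∘ f ∘ e.symm) w = (e' ∘ f ∘ e.symm) (e x) at this
    rw [hval] at this
    exact sub_eq_zero.2 this
  · rw [hval] at hle
    have h3 := map_mono (m := e'.symm) hle
    rw [e'.symm.map_nhds_eq (e'.map_source hfx), e'.left_inv hfx, map_map] at h3
    refine h3.trans ?_
    rw [← e.map_nhds_eq hxs, map_map]
    refine (Filter.map_congr ?_).le
    filter_upwards [e.open_source.mem_nhds hxs,
      hf.continuousAt.eventually (e'.open_source.mem_nhds hfx)] with z hz hfz
    simp [e.left_inv hz, e'.left_inv hfz]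

end Charts

theorem not_isOpen_singleton_of_chartedSpace {X : Type*} [TopologicalSpace X]
    [ChartedSpace ℂ X] (x : X) : ¬ IsOpen ({x} : Set X) := by
  intro h
  have h1 := (chartAt ℂ x).isOpen_image_of_subset_source h
    (Set.singleton_subset_iff.2 (mem_chart_source ℂ x))
  rw [Set.image_singleton] at h1
  exact not_isOpen_singleton _ h1


/-- A map that agrees on an open set with a holomorphic map of open submanifolds is holomorphic
there. -/
theorem contMDiffAt_of_eq_on_opens {M N : Type*} [TopologicalSpace M] [ChartedSpace ℂ M]
    [TopologicalSpace N] [ChartedSpace ℂ N] {U : TopologicalSpace.Opens N}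
    {V : TopologicalSpace.Opens M} {g : U → V} (hg : ContMDiff 𝓘(ℂ) 𝓘(ℂ) ω g) {f : N → M} (hfg : ∀ x : U, f x = g x)
    {x : N} (hx : x ∈ U) : ContMDiffAt 𝓘(ℂ) 𝓘(ℂ) ω f x := by
  have h : ContMDiff 𝓘(ℂ) 𝓘(ℂ) ω fun z : U => f z := by
    rw [show (fun z : U => f z) = Subtype.val ∘ g from funext hfg]
    exact contMDiff_subtype_val.comp hg
  exact contMDiffAt_subtype_iff.1 (h ⟨x, hx⟩)

/-! ### Extending by a point -/

section Extension

variable {M : Type*} [TopologicalSpace M] {N : Type*} [TopologicalSpace N]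

open Classical in
/-- The extension of a map `φ` from an open set to a punctured space by the constant value `p`. -/
noncomputable def extendByPoint [T1Space M] {p : M} {U : TopologicalSpace.Opens N}
    (φ : U → puncture p) (x : N) : M :=
  if h : x ∈ U then φ ⟨x, h⟩ else p

section

variable [T1Space M] {p : M} {U : TopologicalSpace.Opens N} (φ : U → puncture p)

theorem extendByPoint_coe (x : U) : extendByPoint φ x = φ x := by
  simp [extendByPoint]

theorem extendByPoint_eq_iff {x : N} : extendByPoint φ x = p ↔ x ∉ U := by
  constructor
  · intro h hx
    rw [show x = ((⟨x, hx⟩ : U) : N) from rfl, extendByPoint_coe] at h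
    exact (φ ⟨x, hx⟩).2 h
  · intro h
    simp [extendByPoint, h]

end

/-- The extension by a point of a homeomorphism onto a punctured compact space is continuous. -/
theorem continuous_extendByPoint [T1Space M] [CompactSpace M] [T2Space N] {p : M}
    {U : TopologicalSpace.Opens N} (φ : U ≃ₜ puncture p) : Continuous (extendByPoint φ) := by
  refine continuous_def.2 fun V hV => ?_
  by_cases hp : p ∈ V
  -- The complement of the preimage is the image under `φ.symm` of the compact set `Vᶜ`, hence
  -- closed in `N`.
  · have hK : IsCompact ((Subtype.val : puncture p → M) ⁻¹' Vᶜ) := by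
      refine (Topology.IsInducing.subtypeVal.isCompact_preimage_iff ?_).2 hV.isClosed_compl.isCompact
      intro y hy
      exact ⟨⟨y, fun h : y = p => hy (h ▸ hp)⟩, rfl⟩
    have hC := (hK.image (continuous_subtype_val.comp φ.symm.continuous)).isClosed
    convert hC.isOpen_compl using 1
    ext x
    constructor
    · rintro hx ⟨y, hy, rfl⟩
      rw [Set.mem_preimage, Function.comp_apply, extendByPoint_coe, φ.apply_symm_apply] at hx
      exact hy hx
    · intro hx
      by_contra hxV
      by_cases hxU : x ∈ U
      · refine hx ⟨φ ⟨x, hxU⟩, ?_, by simp⟩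
        rw [Set.mem_preimage, show x = ((⟨x, hxU⟩ : U) : N) from rfl, extendByPoint_coe] at hxV
        exact hxV
      · rw [Set.mem_preimage, (extendByPoint_eq_iff φ).2 hxU] at hxV
        exact hxV hp
  · have : extendByPoint φ ⁻¹' V = Subtype.val '' ((fun x => (φ x : M)) ⁻¹' V) := by
      ext x
      constructor
      · intro hx
        have hxU : x ∈ U := by
          by_contra h
          rw [Set.mem_preimage, (extendByPoint_eq_iff φ).2 h] at hx
          exact hp hx
        refine ⟨⟨x, hxU⟩, ?_, rfl⟩
        rw [Set.mem_preimage, show x = ((⟨x, hxU⟩ : U) : N) from rfl, extendByPoint_coe] at hx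
        exact hx
      · rintro ⟨x, hx, rfl⟩
        rwa [Set.mem_preimage, extendByPoint_coe]
    rw [this]
    exact U.isOpen.isOpenMap_subtype_val _
      (hV.preimage (continuous_subtype_val.comp φ.continuous))

end Extension

/-! ### The biholomorphic extension -/

theorem puncture_nonempty {M : Type*} [TopologicalSpace M] [T1Space M] [ChartedSpace ℂ M] (p : M) :
    Nonempty (puncture p) := by
  by_contra h
  refine not_isOpen_singleton_of_chartedSpace p ?_
  convert isOpen_univ (X := M)
  refine Set.eq_univ_of_forall fun y => ?_
  by_contra hy
  exact h ⟨⟨y, hy⟩⟩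

theorem theorem1
    {M : Type*} [TopologicalSpace M] [T2Space M] [CompactSpace M] [ConnectedSpace M]
    [ChartedSpace ℂ M] [IsManifold 𝓘(ℂ) ω M]
    {N : Type*} [TopologicalSpace N] [T2Space N] [CompactSpace N] [ConnectedSpace N]
    [ChartedSpace ℂ N] [IsManifold 𝓘(ℂ) ω N]
    (p : M) (U : TopologicalSpace.Opens N)
    (φ : Biholomorphism U (puncture p)) :
    ∃ Φ : Biholomorphism N M, ∀ x : U, Φ (x : N) = (φ x : M) := by
  set f : N → M := extendByPoint φ with hf
  have hcoe : ∀ x : U, f x = φ x := extendByPoint_coe φ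
  have hfp : ∀ {x}, f x = p ↔ x ∉ U := extendByPoint_eq_iff φ
  have hcont : Continuous f := continuous_extendByPoint φ.toHomeomorph
  have hsm : ∀ x, f x ≠ p → ContMDiffAt 𝓘(ℂ) 𝓘(ℂ) ω f x := fun x hx =>
    contMDiffAt_of_eq_on_opens φ.contMDiff hcoe (by simpa [hfp] using hx)
  have hint : interior (f ⁻¹' {p}) = ∅ := by
    refine (isClopen_iff.1 ⟨isClosed_interior_fiber hcont p hsm, isOpen_interior⟩).resolve_right ?_
    intro h
    obtain ⟨y⟩ := puncture_nonempty p
    have hy : (φ.symm y : N) ∈ f ⁻¹' {p} := interior_subset (h ▸ Set.mem_univ _)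
    exact hfp.1 hy (φ.symm y).2
  have hloc : ∀ x, f x = p → ContMDiffAt 𝓘(ℂ) 𝓘(ℂ) ω f x ∧ 𝓝 p ≤ map f (𝓝 x) := by
    intro x hx
    have := contMDiffAt_and_nhds_le_map hcont x (by rwa [hx]) (by rwa [hx])
    rwa [hx] at this
  have hsmooth : ContMDiff 𝓘(ℂ) 𝓘(ℂ) ω f := fun x =>
    (em (f x = p)).elim (fun h => (hloc x h).1) (hsm x)
  have hinjU : ∀ {x z}, x ∈ U → f x = f z → x = z := by
    intro x z hx h
    have hz : z ∈ U := by
      by_contra hz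
      exact hfp.1 (h.trans (hfp.2 hz)) hx
    have h1 := hcoe ⟨x, hx⟩
    have h2 := hcoe ⟨z, hz⟩
    exact congrArg Subtype.val (φ.injective (Subtype.ext (h1.symm.trans (h.trans h2))))
  have hinj : Function.Injective f := by
    intro x z h
    by_cases hx : x ∈ U
    · exact hinjU hx h
    by_contra hne
    have hxp := hfp.2 hx
    -- Disjoint neighbourhoods of two preimages of `p` have images that are neighbourhoods of `p`
    -- meeting only in `p`, making `p` isolated.
    obtain ⟨A, B, hA, hB, hxA, hzB, hAB⟩ := t2_separation hne
    have h1 := (hloc x hxp).2 (image_mem_map (hA.mem_nhds hxA))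
    have h2 := (hloc z (h ▸ hxp)).2 (image_mem_map (hB.mem_nhds hzB))
    have h3 : f '' A ∩ f '' B ⊆ {p} := by
      rintro _ ⟨⟨a, ha, rfl⟩, b, hb, hab⟩
      by_contra hap
      have haU : a ∈ U := by
        by_contra haU
        exact hap (hfp.2 haU)
      exact Set.disjoint_left.1 hAB ha (hinjU haU hab.symm ▸ hb)
    exact not_isOpen_singleton_of_chartedSpace p <| isOpen_singleton_iff_nhds_eq_pure p |>.2 <|
      le_antisymm (le_pure_iff.2 (mem_of_superset (inter_mem h1 h2) h3)) (pure_le_nhds p)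
  have hsurj : Function.Surjective f := by
    have hr : IsClosed (Set.range f) := (isCompact_range hcont).isClosed
    have hsub : (puncture p : Set M) ⊆ Set.range f := fun y hy =>
      ⟨φ.symm ⟨y, hy⟩, by rw [hcoe, φ.apply_symm_apply]⟩
    intro y
    by_cases hy : y = p
    -- The range is closed and contains `M ∖ {p}`; missing `p` would make `p` isolated.
    · by_contra hyr
      rw [hy] at hyr
      refine not_isOpen_singleton_of_chartedSpace p ?_
      convert hr.isOpen_compl
      ext w
      exact ⟨fun h => h ▸ hyr, fun h => by_contra fun hw => h (hsub hw)⟩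
    · exact hsub hy
  let e : N ≃ₜ M := hcont.homeoOfEquivCompactToT2 (f := Equiv.ofBijective f ⟨hinj, hsurj⟩)
  have he : ∀ x, e x = f x := fun _ => rfl
  have hinv : ∀ y : puncture p, e.symm y = φ.symm y := by
    intro y
    rw [e.symm_apply_eq, he, hcoe, φ.apply_symm_apply]
  have hinvsm : ∀ y, y ≠ p → ContMDiffAt 𝓘(ℂ) 𝓘(ℂ) ω e.symm y := fun y hy =>
    contMDiffAt_of_eq_on_opens (U := puncture p) φ.symm.contMDiff hinv hy
  refine ⟨⟨e.toEquiv, hsmooth, fun y => ?_⟩, hcoe⟩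
  by_cases hy : y = p
  · rw [hy]
    exact contMDiffAt_of_punctured_nhds e.symm.continuous.continuousAt
      (eventually_mem_nhdsWithin.mono hinvsm)
  · exact hinvsm y hy
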